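/- Let $M$ be a smooth, connected, paracompact (Hausdorff) manifold of dimension $d+1$, $d\ge 0$, with a continuous Lorentzian metric $g$ of signature $(-,+,\dots,+)$ and a time orientation, given by a continuous timelike vector field $T$. Let $h$ be a complete smooth Riemannian metric on $M$, with distance $d_h$. A tangent vector $v$ is causal if $v\neq 0$ and $g(v,v)\le 0$, and future causal if moreover $g(T,v)<0$. For real numbers $a\le b$, a curve $\gamma:[a,b]\to M$ is called causal (resp. future causal) if it is locally Lipschitzian, that is, Lipschitz with respect to $d_h$ on each compact subset of $[a,b]$, and its derivative $\gamma'(t)$ exists and is causal (resp. future causal) for almost every $t\in[a,b]$. Its length is $$L(\gamma)=\int_a^b\sqrt{-g(\gamma'(t),\gamma'(t))}\,dt\in[0,\infty].$$ Proposition. Let $\gamma_n:[a,b]\to M$, $n\in\mathbb N$, be future causal curves and let $\gamma:[a,b]\to M$ be a causal curve such that $\gamma_n\to\gamma$ uniformly on $[a,b]$ with respect to $d_h$. Then $$L(\gamma)\ \ge\ \limsup_{n\to\infty}L(\gamma_n).$$ -/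

import Mathlib

open Set Filter Topology MeasureTheory Bundle
open scoped Manifold ContDiff ENNReal NNReal

noncomputable section

/-- A continuous (`C⁰`) Lorentzian metric on a smooth manifold `M` of dimension `d + 1`: a symmetric
bilinear form on each tangent space, of signature `(-, +, …, +)`, which is continuous as a section
of the bundle of bilinear forms on the tangent bundle. -/
structure ContinuousLorentzianMetric (d : ℕ) (M : Type*) [TopologicalSpace M]
    [ChartedSpace (EuclideanSpace ℝ (Fin (d + 1))) M] [IsManifold (𝓡 (d + 1)) ∞ M] where
  /-- The bilinear form on the tangent space at `x`. -/
  form (x : M) : TangentSpace (𝓡 (d + 1)) x →L[ℝ] TangentSpace (𝓡 (d + 1)) x →L[ℝ] ℝ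
  symm (x : M) (v w : TangentSpace (𝓡 (d + 1)) x) : form x v w = form x w v
  signature (x : M) : ∃ e : Module.Basis (Fin (d + 1)) ℝ (TangentSpace (𝓡 (d + 1)) x),
    ∀ i j, form x (e i) (e j) = if i = j then (if i = 0 then -1 else 1) else 0
  continuous : Continuous (fun x : M ↦
    TotalSpace.mk' (EuclideanSpace ℝ (Fin (d + 1)) →L[ℝ] EuclideanSpace ℝ (Fin (d + 1)) →L[ℝ] ℝ)
      (E := fun x : M ↦ TangentSpace (𝓡 (d + 1)) x →L[ℝ] TangentSpace (𝓡 (d + 1)) x →L[ℝ] ℝ)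
      x (form x))

/-- A curve `γ`, considered on the set `I` of parameters only, is locally Lipschitzian if it is
Lipschitz on each compact subset of `I`. -/
def IsLocallyLipschitzian {M : Type*} [PseudoEMetricSpace M] (γ : ℝ → M) (I : Set ℝ) : Prop :=
  ∀ K ⊆ I, IsCompact K → ∃ C : ℝ≥0, LipschitzOnWith C γ K

/-- The velocity `γ'(t)` of a curve `γ`, considered on the set `I` of parameters only
(it is `0` if `γ` is not differentiable at `t`). -/
def curveVelocity (d : ℕ) {M : Type*} [TopologicalSpace M]
    [ChartedSpace (EuclideanSpace ℝ (Fin (d + 1))) M]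
    (γ : ℝ → M) (I : Set ℝ) (t : ℝ) : TangentSpace (𝓡 (d + 1)) (γ t) :=
  mfderivWithin 𝓘(ℝ, ℝ) (𝓡 (d + 1)) γ I t (1 : ℝ)

namespace ContinuousLorentzianMetric

variable {d : ℕ} {M : Type*} [TopologicalSpace M]
  [ChartedSpace (EuclideanSpace ℝ (Fin (d + 1))) M] [IsManifold (𝓡 (d + 1)) ∞ M]

/-- A time orientation of `(M, g)`, given by a continuous timelike vector field `T`. -/
structure TimeOrientation (g : ContinuousLorentzianMetric d M) where
  /-- The vector field, which is future directed by definition. -/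
  field (x : M) : TangentSpace (𝓡 (d + 1)) x
  continuous : Continuous (fun x : M ↦
    (⟨x, field x⟩ : TangentBundle (𝓡 (d + 1)) M))
  timelike (x : M) : g.form x (field x) (field x) < 0

/-- Causal (timelike or null) tangent vectors. -/
def IsCausal (g : ContinuousLorentzianMetric d M) {x : M}
    (v : TangentSpace (𝓡 (d + 1)) x) : Prop :=
  v ≠ 0 ∧ g.form x v v ≤ 0

/-- Future causal tangent vectors: the causal vectors in the same half of the light cone as the
time orientation. -/
def IsFutureCausal (g : ContinuousLorentzianMetric d M) (T : g.TimeOrientation) {x : M}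
    (v : TangentSpace (𝓡 (d + 1)) x) : Prop :=
  g.IsCausal v ∧ g.form x (T.field x) v < 0

/-- The length `L(γ) = ∫ √(-g(γ', γ'))` of a curve `γ : [a, b] → M`. -/
def length (g : ContinuousLorentzianMetric d M) (γ : ℝ → M) (a b : ℝ) : ℝ≥0∞ :=
  ∫⁻ t in Icc a b, ENNReal.ofReal
    (Real.sqrt (-(g.form (γ t) (curveVelocity d γ (Icc a b) t) (curveVelocity d γ (Icc a b) t))))

end ContinuousLorentzianMetric

namespace ContinuousLorentzianMetric

variable {d : ℕ} {M : Type*} [PseudoEMetricSpace M]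
  [ChartedSpace (EuclideanSpace ℝ (Fin (d + 1))) M] [IsManifold (𝓡 (d + 1)) ∞ M]

/-- `γ : [a, b] → M` is a causal curve: locally Lipschitzian, with causal derivative almost
everywhere. -/
def IsCausalCurve (g : ContinuousLorentzianMetric d M) (γ : ℝ → M) (a b : ℝ) : Prop :=
  IsLocallyLipschitzian γ (Icc a b) ∧
    ∀ᵐ t ∂(volume.restrict (Icc a b)), g.IsCausal (curveVelocity d γ (Icc a b) t)

/-- `γ : [a, b] → M` is a future causal curve: locally Lipschitzian, with future causal derivative
almost everywhere. -/
def IsFutureCausalCurve (g : ContinuousLorentzianMetric d M) (T : g.TimeOrientation)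
    (γ : ℝ → M) (a b : ℝ) : Prop :=
  IsLocallyLipschitzian γ (Icc a b) ∧
    ∀ᵐ t ∂(volume.restrict (Icc a b)), g.IsFutureCausal T (curveVelocity d γ (Icc a b) t)

end ContinuousLorentzianMetric

end

/-! The velocities of `γn` need not converge, so lengths are compared with linear functionals, whose
increments depend only on endpoints. For a future timelike `z`, the reversed Cauchy–Schwarz
inequality bounds the length of a future causal vector by its component along `z`
(`sqrt_neg_form_le`). After enlargement by a factor `k > 1`, this bound holds near `p` with one
covector `ℓ` in a fixed chart (`exists_eventually_sqrt_neg_form_le`). Integrating along `γn` and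
letting `n → ∞`, the upper limit of the lengths over a short `[x, y]` is at most the increment of
`ℓ` along `γ` (`exists_ball_limsup_setLIntegral_le`). At almost every `t₀`, its upper right
derivative is thus at most `ℓ` of the velocity of `γ`. Optimising over `z` and `k` gives `√(-g(γ',
γ'))` (`exists_timelike_div_lt`), and `limsup_setLIntegral_Icc_le_of_locallyLipschitz` integrates
this pointwise bound. -/

namespace ContinuousLorentzianMetric

/-! ### Lorentzian linear algebra in one tangent space. -/

variable {d : ℕ} {M : Type*} [TopologicalSpace M]
  [ChartedSpace (EuclideanSpace ℝ (Fin (d + 1))) M] [IsManifold (𝓡 (d + 1)) ∞ M]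
  (g : ContinuousLorentzianMetric d M) {x : M}

/-- A causal vector orthogonal to a timelike vector vanishes. -/
lemma eq_zero_of_form_eq_zero {z y : TangentSpace (𝓡 (d + 1)) x} (hz : g.form x z z < 0)
    (hzy : g.form x z y = 0) (hy : g.form x y y ≤ 0) : y = 0 := by
  obtain ⟨e, he⟩ := g.signature x
  have key : ∀ u w : TangentSpace (𝓡 (d + 1)) x, g.form x u w =
      -(e.repr u 0 * e.repr w 0) + ∑ i : Fin d, e.repr u i.succ * e.repr w i.succ := by
    intro u w
    conv_lhs => rw [← e.sum_repr u, ← e.sum_repr w]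
    simp only [map_sum, map_smul, sum_apply, smul_apply,
      he, smul_eq_mul, mul_ite, mul_zero, Finset.sum_ite_eq', Finset.mem_univ,
      if_true]
    rw [Fin.sum_univ_succ]
    simp [Fin.succ_ne_zero, mul_comm]
  rw [key] at hz hzy hy
  have cs := Finset.sum_mul_sq_le_sq_mul_sq Finset.univ
    (fun i : Fin d ↦ e.repr z i.succ) (fun i : Fin d ↦ e.repr y i.succ)
  simp only [pow_two] at cs
  set S := ∑ i : Fin d, e.repr z i.succ * e.repr z i.succ
  set R := ∑ i : Fin d, e.repr y i.succ * e.repr y i.succ with hR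
  set P := ∑ i : Fin d, e.repr z i.succ * e.repr y i.succ
  have hR0 : 0 ≤ R := Finset.sum_nonneg fun i _ ↦ mul_self_nonneg _
  have hS0 : 0 ≤ S := Finset.sum_nonneg fun i _ ↦ mul_self_nonneg _
  have hP : P = e.repr z 0 * e.repr y 0 := by linarith
  -- Otherwise `z₀² y₀² = P² ≤ S R ≤ S y₀² < z₀² y₀²`.
  have h0 : e.repr y 0 = 0 := by
    by_contra h
    have h1 : 0 < e.repr y 0 * e.repr y 0 := mul_self_pos.2 h
    rw [hP] at cs
    nlinarith
  have hR1 : R = 0 := by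
    rw [h0] at hy
    linarith
  rw [hR, Finset.sum_eq_zero_iff_of_nonneg fun i _ ↦ mul_self_nonneg _] at hR1
  apply e.repr.injective
  ext i
  refine Fin.cases ?_ (fun j ↦ ?_) i
  · simpa using h0
  · simpa using hR1 j (Finset.mem_univ j)

/-- The reversed Cauchy–Schwarz inequality with respect to a timelike vector. -/
lemma form_mul_form_le_sq {z : TangentSpace (𝓡 (d + 1)) x} (hz : g.form x z z < 0)
    (u : TangentSpace (𝓡 (d + 1)) x) :
    g.form x u u * g.form x z z ≤ g.form x u z ^ 2 := by
  -- A multiple of the projection of `u` to the orthogonal complement of `z`; it would be timelike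
  -- if the inequality failed.
  set y := g.form x z z • u - g.form x u z • z with hy
  have h1 : g.form x z y = 0 := by
    simp only [hy, map_sub, map_smul, smul_eq_mul, g.symm x z u]
    ring
  have h2 : g.form x y y = g.form x z z * (g.form x u u * g.form x z z - g.form x u z ^ 2) := by
    simp only [hy, map_sub, map_smul, smul_eq_mul, sub_apply,
      smul_apply, g.symm x z u]
    ring
  by_contra! h
  have h3 : g.form x y y < 0 := by
    rw [h2]
    exact mul_neg_of_neg_of_pos hz (by linarith)
  have := g.eq_zero_of_form_eq_zero hz h1 h3.le
  simp [this] at h3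

/-- Causal vectors in the same half of the light cone as two timelike vectors. -/
lemma form_neg_of_isCausal {u z τ : TangentSpace (𝓡 (d + 1)) x} (hu : g.IsCausal u)
    (hz : g.form x z z < 0) (hτ : g.form x τ τ < 0) (hzτ : g.form x z τ < 0)
    (huτ : g.form x τ u ≤ 0) : g.form x u z < 0 := by
  by_contra! h
  have h0 : g.form x τ u < 0 :=
    huτ.lt_of_ne fun h' ↦ hu.1 (g.eq_zero_of_form_eq_zero hτ h' hu.2)
  -- This combination is orthogonal to `u`, and the assumed sign of `g(u, z)` makes it timelike.
  set w := g.form x u z • τ - g.form x τ u • z with hw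
  have h1 : g.form x w u = 0 := by
    simp only [hw, map_sub, map_smul, smul_eq_mul, sub_apply,
      smul_apply, g.symm x z u]
    ring
  have h2 : g.form x w w = g.form x u z ^ 2 * g.form x τ τ
      - 2 * (g.form x u z * (g.form x τ u * g.form x z τ)) + g.form x τ u ^ 2 * g.form x z z := by
    simp only [hw, map_sub, map_smul, smul_eq_mul, sub_apply,
      smul_apply, g.symm x τ z]
    ring
  have h3 : g.form x w w < 0 := by
    rw [h2]
    have i1 : g.form x u z ^ 2 * g.form x τ τ ≤ 0 :=
      mul_nonpos_of_nonneg_of_nonpos (sq_nonneg _) hτ.le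
    have i2 : 0 ≤ g.form x u z * (g.form x τ u * g.form x z τ) :=
      mul_nonneg h (mul_pos_of_neg_of_neg h0 hzτ).le
    have i3 : g.form x τ u ^ 2 * g.form x z z < 0 :=
      mul_neg_of_pos_of_neg (sq_pos_of_neg h0) hz
    linarith
  exact hu.1 (g.eq_zero_of_form_eq_zero h3 h1 hu.2)

/-- The Lorentzian length of a future causal vector is at most its component along a future
timelike vector. -/
lemma sqrt_neg_form_le {u z τ : TangentSpace (𝓡 (d + 1)) x} (hu : g.IsCausal u)
    (hz : g.form x z z < 0) (hτ : g.form x τ τ < 0) (hzτ : g.form x z τ < 0)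
    (huτ : g.form x τ u ≤ 0) :
    √(-g.form x u u) ≤ -g.form x u z / √(-g.form x z z) := by
  have h1 := g.form_neg_of_isCausal hu hz hτ hzτ huτ
  rw [le_div_iff₀ (Real.sqrt_pos.2 (by linarith)), ← Real.sqrt_mul (by linarith [hu.2])]
  apply Real.sqrt_le_iff.2 ⟨by linarith, ?_⟩
  have := g.form_mul_form_le_sq hz u
  nlinarith

/-- The Lorentzian length of a causal vector is approximated by its components along suitable
future timelike vectors. -/
lemma exists_timelike_div_lt {v τ : TangentSpace (𝓡 (d + 1)) x} (hv : g.form x v v ≤ 0)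
    (hτ : g.form x τ τ < 0) {c : ℝ} (hc : √(-g.form x v v) < c) :
    ∃ z : TangentSpace (𝓡 (d + 1)) x, g.form x z z < 0 ∧ g.form x z τ < 0 ∧
      -g.form x v z / √(-g.form x z z) < c := by
  have hc0 : 0 < c := (Real.sqrt_nonneg _).trans_lt hc
  rcases le_or_gt 0 (g.form x v τ) with h | h
  -- A vector not in the future half has nonpositive component along `τ`; hence the limit curve
  -- needs no time orientation.
  · exact ⟨τ, hτ, hτ, (div_nonpos_of_nonpos_of_nonneg (by linarith) (Real.sqrt_nonneg _)).trans_lt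
      hc0⟩
  -- The optimal `z` would be `v`, which may be null; `z = v + k τ` with small `k > 0` is timelike,
  -- and `N k = -g(z, z)`.
  · set N : ℝ → ℝ := fun k ↦ -g.form x v v - 2 * k * g.form x v τ - k ^ 2 * g.form x τ τ with hN
    have hlim : ∀ᶠ k in 𝓝[>] (0 : ℝ), √(N k) < c := by
      have : ContinuousAt (fun k ↦ √(N k)) 0 := by fun_prop
      have h' := this.eventually_lt (f := fun k ↦ √(N k)) (g := fun _ ↦ c) continuousAt_const
        (by simpa [hN] using hc)
      exact h'.filter_mono nhdsWithin_le_nhds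
    obtain ⟨k, hk, hk0⟩ := (hlim.and self_mem_nhdsWithin).exists
    have hk0 : 0 < k := hk0
    have e1 : g.form x (v + k • τ) (v + k • τ) = -N k := by
      simp only [hN, map_add, map_smul, smul_eq_mul, add_apply,
        smul_apply, g.symm x τ v]
      ring
    have e2 : k * g.form x v τ < 0 := mul_neg_of_pos_of_neg hk0 h
    have e3 : k ^ 2 * g.form x τ τ < 0 := mul_neg_of_pos_of_neg (by positivity) hτ
    have hNk : 0 < N k := by simp only [hN]; linarith
    refine ⟨v + k • τ, by linarith, ?_, ?_⟩
    · simp only [map_add, map_smul, smul_eq_mul, add_apply,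
        smul_apply]
      nlinarith
    · rw [e1, neg_neg, div_lt_iff₀ (Real.sqrt_pos.2 hNk)]
      have e4 : -g.form x v (v + k • τ) ≤ N k := by
        simp only [hN, map_add, map_smul, smul_eq_mul]
        linarith
      calc _ ≤ N k := e4
        _ = √(N k) * √(N k) := (Real.mul_self_sqrt hNk.le).symm
        _ < c * √(N k) := by gcongr

end ContinuousLorentzianMetric

/-! ### Velocities of curves read in a chart. -/

section ChartDerivative

variable {E : Type*} [NormedAddCommGroup E] [NormedSpace ℝ E] {H : Type*} [TopologicalSpace H]
  {I : ModelWithCorners ℝ E H} {M : Type*} [TopologicalSpace M] [ChartedSpace H M]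
  [IsManifold I 1 M]

/-- The derivative of a curve read in a chart, in terms of the trivialization of the tangent
bundle. -/
lemma MDifferentiableWithinAt.hasDerivWithinAt_extChartAt_comp {γ : ℝ → M} {s : Set ℝ} {t : ℝ}
    (hγ : MDifferentiableWithinAt 𝓘(ℝ, ℝ) I γ s t) {p : M} (hp : γ t ∈ (chartAt H p).source) :
    HasDerivWithinAt (extChartAt I p ∘ γ)
      ((trivializationAt E (TangentSpace I) p).continuousLinearMapAt ℝ (γ t)
        (mfderivWithin 𝓘(ℝ, ℝ) I γ s t (1 : ℝ))) s t := by
  have h1 : HasMFDerivWithinAt 𝓘(ℝ, ℝ) 𝓘(ℝ, E) (extChartAt I p ∘ γ) s t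
      ((mfderiv I 𝓘(ℝ, E) (extChartAt I p) (γ t)).comp (mfderivWithin 𝓘(ℝ, ℝ) I γ s t)) :=
    (mdifferentiableAt_extChartAt hp).hasMFDerivAt.comp_hasMFDerivWithinAt t hγ.hasMFDerivWithinAt
  have h2 : HasFDerivWithinAt (extChartAt I p ∘ γ) (show ℝ →L[ℝ] E from
      (mfderiv I 𝓘(ℝ, E) (extChartAt I p) (γ t)).comp (mfderivWithin 𝓘(ℝ, ℝ) I γ s t)) s t :=
    h1.hasFDerivWithinAt
  rw [TangentBundle.continuousLinearMapAt_trivializationAt hp]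
  exact h2.hasDerivWithinAt

end ChartDerivative

/-! ### Charts are locally Lipschitz for the Riemannian distance. -/

section Riemannian

/-- Trivializations of a Riemannian vector bundle are locally bounded. -/
lemma eventually_norm_continuousLinearMapAt_le {B : Type*} [TopologicalSpace B] (F : Type*)
    [NormedAddCommGroup F] [NormedSpace ℝ F] (V : B → Type*) [TopologicalSpace (TotalSpace F V)]
    [∀ x, NormedAddCommGroup (V x)] [∀ x, InnerProductSpace ℝ (V x)] [FiberBundle F V]
    [VectorBundle ℝ F V] [IsContinuousRiemannianBundle F V] (p : B) :
    ∃ C : ℝ≥0, ∀ᶠ x in 𝓝 p, ∀ v : V x,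
      ‖(trivializationAt F V p).continuousLinearMapAt ℝ x v‖ₑ ≤ C * ‖v‖ₑ := by
  obtain ⟨C, C0, hC⟩ := eventually_norm_trivializationAt_lt F V p
  lift C to ℝ≥0 using C0.le
  refine ⟨C, ?_⟩
  filter_upwards [hC] with x hx v
  simp only [enorm]
  exact_mod_cast ((trivializationAt F V p).continuousLinearMapAt ℝ x).le_of_opNorm_le hx.le v

lemma IsContMDiffRiemannianBundle.isContinuousRiemannianBundle
    {EB : Type*} [NormedAddCommGroup EB] [NormedSpace ℝ EB] {HB : Type*} [TopologicalSpace HB]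
    (IB : ModelWithCorners ℝ EB HB) {n : ℕ∞ω} {B : Type*} [TopologicalSpace B] [ChartedSpace HB B]
    {F : Type*} [NormedAddCommGroup F] [NormedSpace ℝ F] {V : B → Type*}
    [TopologicalSpace (TotalSpace F V)] [∀ x, NormedAddCommGroup (V x)]
    [∀ x, InnerProductSpace ℝ (V x)] [FiberBundle F V] [VectorBundle ℝ F V]
    [h : IsContMDiffRiemannianBundle IB n F V] : IsContinuousRiemannianBundle F V := by
  obtain ⟨g, hg, hgi⟩ := h.exists_contMDiff
  exact ⟨g, hg.continuous, hgi⟩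

open Manifold

variable {E : Type*} [NormedAddCommGroup E] [NormedSpace ℝ E] {H : Type*} [TopologicalSpace H]
  (I : ModelWithCorners ℝ E H) {M : Type*} [PseudoEMetricSpace M] [ChartedSpace H M]
  [IsManifold I 1 M] [RiemannianBundle (fun x : M ↦ TangentSpace I x)]

/-- The image in a chart of a `C¹` path along which the derivative of the chart is bounded. -/
lemma edist_extChartAt_le_mul_pathELength (p : M) {C : ℝ≥0} {γ : ℝ → M}
    (hγ : ContMDiffOn 𝓘(ℝ) I 1 γ (Icc 0 1))
    (hs : ∀ t ∈ Icc (0 : ℝ) 1, γ t ∈ (chartAt H p).source)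
    (hC : ∀ t ∈ Icc (0 : ℝ) 1, ∀ v : TangentSpace I (γ t),
      ‖(trivializationAt E (TangentSpace I) p).continuousLinearMapAt ℝ (γ t) v‖ₑ ≤ C * ‖v‖ₑ) :
    edist (extChartAt I p (γ 1)) (extChartAt I p (γ 0)) ≤ C * pathELength I γ 0 1 := by
  let γ' := extChartAt I p ∘ γ
  have hC' : ContMDiffOn 𝓘(ℝ) 𝓘(ℝ, E) 1 γ' (Icc 0 1) :=
    contMDiffOn_extChartAt.comp (I' := I) (t := (chartAt H p).source) hγ hs
  calc
    edist (extChartAt I p (γ 1)) (extChartAt I p (γ 0)) = ‖γ' 1 - γ' 0‖ₑ := edist_eq_enorm_sub _ _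
    _ ≤ ∫⁻ t' in Icc 0 1, ‖derivWithin γ' (Icc 0 1) t'‖ₑ := by
      apply enorm_sub_le_lintegral_derivWithin_Icc_of_contDiffOn_Icc _ zero_le_one
      rwa [← contMDiffOn_iff_contDiffOn]
    _ ≤ ∫⁻ t' in Icc 0 1, C * ‖mfderivWithin 𝓘(ℝ) I γ (Icc 0 1) t' (1 : ℝ)‖ₑ := by
      apply setLIntegral_mono' measurableSet_Icc (fun t' ht' ↦ ?_)
      rw [((hγ.mdifferentiableOn one_ne_zero _ ht').hasDerivWithinAt_extChartAt_comp
        (hs t' ht')).derivWithin (uniqueDiffOn_Icc zero_lt_one _ ht')]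
      exact hC t' ht' _
    _ = C * pathELength I γ 0 1 := by
      rw [lintegral_const_mul' _ _ ENNReal.coe_ne_top,
          pathELength_eq_lintegral_mfderivWithin_Icc]
      rfl

variable [IsContinuousRiemannianBundle E (fun x : M ↦ TangentSpace I x)] [IsRiemannianManifold I M]

/-- Charts of a Riemannian manifold are locally Lipschitz for the Riemannian distance. -/
lemma exists_lipschitzOnWith_extChartAt (p : M) :
    ∃ C : ℝ≥0, ∃ U ∈ 𝓝 p, LipschitzOnWith C (extChartAt I p) U := by
  obtain ⟨C, hC⟩ := eventually_norm_continuousLinearMapAt_le E (fun x : M ↦ TangentSpace I x) p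
  obtain ⟨r, r_pos, hr⟩ := EMetric.mem_nhds_iff.1
    (Filter.inter_mem hC (chart_source_mem_nhds H p))
  have r4 : 0 < r / 4 := ENNReal.div_pos r_pos.ne' (by simp)
  -- Two points of this ball are less than `r / 2` apart, so nearly shortest paths between them stay
  -- in the ball of radius `r`, where the chart derivative is bounded.
  refine ⟨C, Metric.eball p (r / 4), Metric.eball_mem_nhds p r4, fun y hy x hx ↦ ?_⟩
  have hd : edist x y < r / 4 + r / 4 :=
    (edist_triangle_right x y p).trans_lt (ENNReal.add_lt_add hx hy)
  have key : ∀ ρ, edist x y < ρ → ρ < r / 4 + r / 4 →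
      edist (extChartAt I p y) (extChartAt I p x) ≤ C * ρ := by
    intro ρ hρ hρr
    rw [IsRiemannianManifold.out (I := I) x y] at hρ
    obtain ⟨γ, γ0, γ1, γ_smooth, hγ⟩ := exists_lt_of_riemannianEDist_lt hρ
    have hmem : ∀ t ∈ Icc (0 : ℝ) 1, γ t ∈ Metric.eball p r := by
      intro t ht
      have h1 : edist x (γ t) ≤ ρ := by
        rw [IsRiemannianManifold.out (I := I) x (γ t)]
        exact (riemannianEDist_le_pathELength
          (γ_smooth.mono (Icc_subset_Icc le_rfl ht.2)) γ0 rfl ht.1).trans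
          ((pathELength_mono le_rfl ht.2).trans hγ.le)
      rw [Metric.mem_eball, edist_comm]
      calc edist p (γ t) ≤ edist p x + edist x (γ t) := edist_triangle _ _ _
        _ < r / 4 + (r / 4 + r / 4) := by
          rw [edist_comm p x]
          exact ENNReal.add_lt_add hx (h1.trans_lt hρr)
        _ ≤ (r / 4 + r / 4) + (r / 4 + r / 4) := by
          rw [← add_assoc, ← add_assoc]
          exact le_self_add
        _ = r := by
          have : r / 4 + r / 4 = r / 2 := by
            rw [← two_mul, div_eq_mul_inv, div_eq_mul_inv, mul_left_comm]
            congr 1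
            rw [show (4 : ℝ≥0∞) = 2 * 2 by norm_num, ENNReal.mul_inv (by simp) (by simp),
              ← mul_assoc, ENNReal.mul_inv_cancel (by simp) (by simp), one_mul]
          rw [this, ENNReal.add_halves]
    have := edist_extChartAt_le_mul_pathELength I p γ_smooth (fun t ht ↦ (hr (hmem t ht)).2)
      (fun t ht ↦ (hr (hmem t ht)).1) (C := C)
    rw [γ0, γ1] at this
    exact this.trans (by gcongr)
  rw [edist_comm y x]
  have hlim : Tendsto (fun ρ ↦ (C : ℝ≥0∞) * ρ) (𝓝[>] (edist x y)) (𝓝 (C * edist x y)) :=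
    (ENNReal.Tendsto.const_mul tendsto_id (Or.inr ENNReal.coe_ne_top)).mono_left
      nhdsWithin_le_nhds
  have : (𝓝[>] (edist x y)).NeBot := nhdsGT_neBot_of_exists_gt ⟨_, hd⟩
  refine ge_of_tendsto hlim ?_
  filter_upwards [Ioo_mem_nhdsGT hd] with ρ hρ using key ρ hρ.1 hρ.2

end Riemannian

/-! ### Upper limits of integrals as functions of the interval. -/

section LimsupIntegral

lemma ENNReal.limsup_add_le_limsup_add_limsup {ι : Type*} {l : Filter ι} (u v : ι → ℝ≥0∞) :
    limsup (fun i ↦ u i + v i) l ≤ limsup u l + limsup v l := by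
  rcases eq_or_ne (limsup u l) ⊤ with hu | hu
  · simp [hu]
  rcases eq_or_ne (limsup v l) ⊤ with hv | hv
  · simp [hv]
  refine ENNReal.le_of_forall_pos_le_add fun ε hε _ ↦ ?_
  have h2 : (0 : ℝ≥0∞) < ((ε / 2 : ℝ≥0) : ℝ≥0∞) := by
    exact_mod_cast half_pos hε
  refine limsup_le_of_le (h := ?_)
  filter_upwards [eventually_lt_of_limsup_lt (ENNReal.lt_add_right hu h2.ne'),
    eventually_lt_of_limsup_lt (ENNReal.lt_add_right hv h2.ne')] with i h3 h4
  calc u i + v i ≤ (limsup u l + (ε / 2 : ℝ≥0)) + (limsup v l + (ε / 2 : ℝ≥0)) :=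
        add_le_add h3.le h4.le
    _ = limsup u l + limsup v l + ((ε / 2 + ε / 2 : ℝ≥0) : ℝ≥0∞) := by
        rw [ENNReal.coe_add]
        ring
    _ = limsup u l + limsup v l + ε := by rw [add_halves]

lemma limsup_setLIntegral_Icc_le_add (f : ℕ → ℝ → ℝ≥0∞) {s x y : ℝ} (hx : s ≤ x) (hy : x ≤ y) :
    limsup (fun n ↦ ∫⁻ t in Icc s y, f n t) atTop ≤
      limsup (fun n ↦ ∫⁻ t in Icc s x, f n t) atTop +
        limsup (fun n ↦ ∫⁻ t in Icc x y, f n t) atTop := by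
  refine (limsup_le_limsup (.of_forall fun n ↦ ?_)).trans
    (ENNReal.limsup_add_le_limsup_add_limsup _ _)
  rw [← Icc_union_Icc_eq_Icc hx hy]
  exact lintegral_union_le _ _ _

lemma setLIntegral_Icc_add (f : ℝ → ℝ≥0∞) {s x y : ℝ} (hx : s ≤ x) (hy : x ≤ y) :
    (∫⁻ t in Icc s x, f t) + ∫⁻ t in Icc x y, f t = ∫⁻ t in Icc s y, f t := by
  rw [← restrict_Ioc_eq_restrict_Icc (a := x), ← Icc_union_Ioc_eq_Icc hx hy,
    lintegral_union measurableSet_Ioc]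
  exact Set.disjoint_left.2 fun t (h1 : t ∈ Icc s x) (h2 : t ∈ Ioc x y) ↦ h2.1.not_ge h1.2

/-- If the upper limit of the integrals over small intervals has Lipschitz bounds, it is controlled
by the integral of its upper right derivative. -/
lemma limsup_setLIntegral_Icc_le_of_lipschitz {f : ℕ → ℝ → ℝ≥0∞} {φ : ℝ → ℝ} {a b : ℝ}
    (hab : a ≤ b) {C : ℝ≥0}
    (hC : ∀ x ∈ Icc a b, ∀ y ∈ Icc a b, x ≤ y →
      limsup (fun n ↦ ∫⁻ t in Icc x y, f n t) atTop ≤ ENNReal.ofReal (C * (y - x)))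
    (hφ : ∀ᵐ x ∂(volume.restrict (Icc a b)), ∀ c, φ x < c → ∀ᶠ y in 𝓝[>] x,
      limsup (fun n ↦ ∫⁻ t in Icc x y, f n t) atTop ≤ ENNReal.ofReal (c * (y - x))) :
    limsup (fun n ↦ ∫⁻ t in Icc a b, f n t) atTop ≤ ∫⁻ t in Icc a b, ENNReal.ofReal (φ t) := by
  -- Subadditivity of the upper limit bounds the increments of `Λ`; being Lipschitz, `Λ` is
  -- recovered from its derivative.
  set Λ : ℝ → ℝ≥0∞ := fun x ↦ limsup (fun n ↦ ∫⁻ t in Icc a x, f n t) atTop with hΛ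
  have hfin : ∀ x ∈ Icc a b, Λ x ≠ ⊤ := fun x hx ↦
    ((hC a (left_mem_Icc.2 hab) x hx hx.1).trans_lt ENNReal.ofReal_lt_top).ne
  have hadd : ∀ x ∈ Icc a b, ∀ y ∈ Icc a b, x ≤ y → ∀ k,
      limsup (fun n ↦ ∫⁻ t in Icc x y, f n t) atTop ≤ ENNReal.ofReal k → 0 ≤ k →
      (Λ y).toReal ≤ (Λ x).toReal + k := by
    intro x hx y hy hxy k hk hk0
    refine ENNReal.toReal_le_of_le_ofReal (add_nonneg ENNReal.toReal_nonneg hk0) ?_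
    rw [ENNReal.ofReal_add ENNReal.toReal_nonneg hk0, ENNReal.ofReal_toReal (hfin x hx)]
    exact (limsup_setLIntegral_Icc_le_add f hx.1 hxy).trans (by gcongr)
  have hmono : ∀ x ∈ Icc a b, ∀ y ∈ Icc a b, x ≤ y → (Λ x).toReal ≤ (Λ y).toReal := by
    intro x hx y hy hxy
    refine ENNReal.toReal_mono (hfin y hy) (limsup_le_limsup (.of_forall fun n ↦ ?_))
    exact lintegral_mono_set (Icc_subset_Icc le_rfl hxy)
  have hlip : LipschitzOnWith C (fun x ↦ (Λ x).toReal) (uIcc a b) := by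
    rw [uIcc_of_le hab]
    have : ∀ x ∈ Icc a b, ∀ y ∈ Icc a b, x ≤ y →
        dist (Λ x).toReal (Λ y).toReal ≤ C * dist x y := by
      intro x hx y hy hxy
      have h0 : 0 ≤ C * (y - x) := mul_nonneg C.2 (sub_nonneg.2 hxy)
      rw [dist_comm, Real.dist_eq, dist_comm, Real.dist_eq,
        abs_of_nonneg (sub_nonneg.2 (hmono x hx y hy hxy)), abs_of_nonneg (sub_nonneg.2 hxy)]
      linarith [hadd x hx y hy hxy _ (hC x hx y hy hxy) h0]
    refine LipschitzOnWith.of_dist_le_mul fun x hx y hy ↦ ?_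
    rcases le_total x y with h | h
    · exact this x hx y hy h
    · rw [dist_comm, dist_comm x]
      exact this y hy x hx h
  have hac := hlip.absolutelyContinuousOnInterval
  -- The maximum with `0` reflects the truncation in `ENNReal.ofReal`; it costs nothing, since the
  -- conclusion truncates too.
  have hderiv : ∀ᵐ x ∂(volume.restrict (Ioo a b)),
      deriv (fun x ↦ (Λ x).toReal) x ≤ max (φ x) 0 := by
    have h1 := hlip.ae_differentiableWithinAt_of_mem_real
    have h2 := ae_restrict_of_ae_restrict_of_subset Ioo_subset_Icc_self hφ
    filter_upwards [h2, ae_restrict_of_ae h1, ae_restrict_mem measurableSet_Ioo] with x h2 h1 hx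
    have hx' : Icc a b ∈ 𝓝 x := Icc_mem_nhds hx.1 hx.2
    rw [uIcc_of_le hab] at h1
    have hd := ((h1 (Ioo_subset_Icc_self hx)).differentiableAt hx').hasDerivAt
    refine le_of_forall_gt_imp_ge_of_dense fun c hc ↦ ?_
    have hs := (hasDerivAt_iff_tendsto_slope.1 hd).mono_left
      (nhdsGT_le_nhdsNE x)
    refine le_of_tendsto hs ?_
    filter_upwards [h2 c ((le_max_left _ _).trans_lt hc), self_mem_nhdsWithin,
      nhdsWithin_le_nhds hx'] with y h3 h4 h5
    have h4' : 0 < y - x := sub_pos.2 h4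
    have hc0 : 0 ≤ c := (le_max_right _ _).trans hc.le
    rw [slope_def_field, div_le_iff₀ h4']
    linarith [hadd x (Ioo_subset_Icc_self hx) y h5 (le_of_lt h4) _ h3 (by positivity)]
  have hint := hac.integral_deriv_eq_sub
  have h0 : Λ a = 0 := by simp [hΛ]
  rw [intervalIntegral.integral_of_le hab, h0, ENNReal.toReal_zero, sub_zero,
    integral_Ioc_eq_integral_Ioo] at hint
  have hII : IntegrableOn (deriv fun x ↦ (Λ x).toReal) (Ioo a b) :=
    ((intervalIntegrable_iff_integrableOn_Ioc_of_le hab).1 hac.intervalIntegrable_deriv).mono_set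
      Ioo_subset_Ioc_self
  rw [integral_eq_lintegral_pos_part_sub_lintegral_neg_part hII] at hint
  calc Λ b = ENNReal.ofReal (Λ b).toReal := (ENNReal.ofReal_toReal (hfin b ⟨hab, le_rfl⟩)).symm
    _ ≤ ENNReal.ofReal
        (∫⁻ x in Ioo a b, ENNReal.ofReal (deriv (fun x ↦ (Λ x).toReal) x)).toReal := by
      rw [← hint]
      exact ENNReal.ofReal_le_ofReal (sub_le_self _ ENNReal.toReal_nonneg)
    _ ≤ ∫⁻ x in Ioo a b, ENNReal.ofReal (deriv (fun x ↦ (Λ x).toReal) x) :=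
      ENNReal.ofReal_toReal_le
    _ ≤ ∫⁻ x in Ioo a b, ENNReal.ofReal (φ x) := by
      refine lintegral_mono_ae ?_
      filter_upwards [hderiv] with x hx
      simpa using ENNReal.ofReal_le_ofReal hx
    _ = ∫⁻ x in Icc a b, ENNReal.ofReal (φ x) := by rw [restrict_Ioo_eq_restrict_Icc]

/-- If the upper limit of the integrals over small intervals has local Lipschitz bounds, it is
controlled by the integral of its upper right derivative. -/
lemma limsup_setLIntegral_Icc_le_of_locallyLipschitz {f : ℕ → ℝ → ℝ≥0∞} {φ : ℝ → ℝ} {a b : ℝ}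
    (hab : a ≤ b)
    (hC : ∀ t₀ ∈ Icc a b, ∃ r > 0, ∃ C : ℝ≥0, ∀ x ∈ Icc a b, ∀ y ∈ Icc a b,
      x ∈ Metric.ball t₀ r → y ∈ Metric.ball t₀ r → x ≤ y →
      limsup (fun n ↦ ∫⁻ t in Icc x y, f n t) atTop ≤ ENNReal.ofReal (C * (y - x)))
    (hφ : ∀ᵐ x ∂(volume.restrict (Icc a b)), ∀ c, φ x < c → ∀ᶠ y in 𝓝[>] x,
      limsup (fun n ↦ ∫⁻ t in Icc x y, f n t) atTop ≤ ENNReal.ofReal (c * (y - x))) :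
    limsup (fun n ↦ ∫⁻ t in Icc a b, f n t) atTop ≤ ∫⁻ t in Icc a b, ENNReal.ofReal (φ t) := by
  choose! r hr C hC using hC
  -- By compactness, finitely many consecutive intervals, each inside one ball, cover `[a, b]`.
  obtain ⟨t, ht0, htm, ⟨m, hm⟩, ht⟩ := exists_monotone_Icc_subset_open_cover_Icc hab
    (c := fun t₀ : Icc a b ↦ Metric.ball t₀ (r t₀)) (fun _ ↦ Metric.isOpen_ball)
    (fun x _ ↦ mem_iUnion.2 ⟨x, Metric.mem_ball_self (hr x x.2)⟩)
  have key : ∀ n, limsup (fun k ↦ ∫⁻ x in Icc a (t n), f k x) atTop ≤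
      ∫⁻ x in Icc a (t n), ENNReal.ofReal (φ x) := by
    intro n
    induction n with
    | zero => simp [ht0]
    | succ n ih =>
      have hn : (t n : ℝ) ≤ t (n + 1) := htm n.le_succ
      rw [← setLIntegral_Icc_add _ (t n).2.1 hn]
      refine (limsup_setLIntegral_Icc_le_add f (t n).2.1 hn).trans (add_le_add ih ?_)
      obtain ⟨t₀, ht₀⟩ := ht n
      have hsub : Icc (t n : ℝ) (t (n + 1)) ⊆ Icc a b := Icc_subset_Icc (t n).2.1 (t (n + 1)).2.2
      have hball : ∀ x ∈ Icc (t n : ℝ) (t (n + 1)), x ∈ Metric.ball (t₀ : ℝ) (r t₀) :=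
        fun x hx ↦ ht₀ (a := ⟨x, hsub hx⟩) hx
      exact limsup_setLIntegral_Icc_le_of_lipschitz hn
        (fun x hx y hy ↦ hC t₀ t₀.2 x (hsub hx) y (hsub hy) (hball x hx) (hball y hy))
        (ae_restrict_of_ae_restrict_of_subset hsub hφ)
  simpa [hm m le_rfl] using key m

end LimsupIntegral

/-- The default velocity is `0`, so a causal velocity, being nonzero, certifies differentiability.
-/
lemma mdifferentiableWithinAt_of_curveVelocity_ne_zero {d : ℕ} {M : Type*} [TopologicalSpace M]
    [ChartedSpace (EuclideanSpace ℝ (Fin (d + 1))) M] {γ : ℝ → M} {I : Set ℝ} {t : ℝ}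
    (h : curveVelocity d γ I t ≠ 0) : MDifferentiableWithinAt 𝓘(ℝ, ℝ) (𝓡 (d + 1)) γ I t := by
  by_contra h'
  exact h (by rw [curveVelocity, mfderivWithin_zero_of_not_mdifferentiableWithinAt h']; rfl)

namespace ContinuousLorentzianMetric

/-! ### Linear bounds for the Lorentzian length near a point. -/

section Cone

variable {d : ℕ} {M : Type*} [TopologicalSpace M]
  [ChartedSpace (EuclideanSpace ℝ (Fin (d + 1))) M] [IsManifold (𝓡 (d + 1)) ∞ M]
  (g : ContinuousLorentzianMetric d M)

lemma continuousAt_form {X : Type*} [TopologicalSpace X] {b : X → M} {x : X}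
    {v w : ∀ y, TangentSpace (𝓡 (d + 1)) (b y)}
    (hv : ContinuousAt (fun y ↦ TotalSpace.mk' (EuclideanSpace ℝ (Fin (d + 1))) (b y) (v y)) x)
    (hw : ContinuousAt (fun y ↦ TotalSpace.mk' (EuclideanSpace ℝ (Fin (d + 1))) (b y) (w y)) x) :
    ContinuousAt (fun y ↦ g.form (b y) (v y) (w y)) x := by
  have hb : ContinuousAt b x := (FiberBundle.continuousAt_totalSpace _ _).1 hv |>.1
  have : ContinuousAt (fun y ↦ TotalSpace.mk' ℝ (E := Bundle.Trivial M ℝ) (b y)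
      (g.form (b y) (v y) (w y))) x :=
    (g.continuous.continuousAt.comp hb).clm_bundle_apply₂
      (F₁ := EuclideanSpace ℝ (Fin (d + 1))) (F₂ := EuclideanSpace ℝ (Fin (d + 1))) hv hw
  exact ((FiberBundle.continuousAt_totalSpace _ _).1 this).2

/-- Near a point, the Lorentzian length of future causal vectors is bounded, up to a factor close
to one, by their component in the chart along a given future timelike vector. -/
lemma exists_eventually_sqrt_neg_form_le (T : g.TimeOrientation) {p : M}
    {z : TangentSpace (𝓡 (d + 1)) p} (hz : g.form p z z < 0) (hzT : g.form p z (T.field p) < 0)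
    {k : ℝ} (hk : 1 < k) :
    ∃ ℓ : EuclideanSpace ℝ (Fin (d + 1)) →L[ℝ] ℝ,
      (∀ v : TangentSpace (𝓡 (d + 1)) p,
        ℓ ((trivializationAt (EuclideanSpace ℝ (Fin (d + 1))) (TangentSpace (𝓡 (d + 1)))
          p).continuousLinearMapAt ℝ p v) = k * (-g.form p v z / √(-g.form p z z))) ∧
      ∀ᶠ x in 𝓝 p, ∀ v : TangentSpace (𝓡 (d + 1)) x, g.IsFutureCausal T v →
        √(-g.form x v v) ≤ ℓ ((trivializationAt (EuclideanSpace ℝ (Fin (d + 1)))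
          (TangentSpace (𝓡 (d + 1))) p).continuousLinearMapAt ℝ x v) := by
  set F := EuclideanSpace ℝ (Fin (d + 1))
  set e := trivializationAt F (TangentSpace (𝓡 (d + 1)) : M → Type _) p with he
  have hp : p ∈ e.baseSet := mem_baseSet_trivializationAt F _ p
  -- The covector is frozen at `p`; `k > 1` makes the bound strict on causal directions, so it
  -- survives moving the base point.
  let ℓ : F →L[ℝ] ℝ := (-(k / √(-g.form p z z))) • ((g.form p z).comp (e.symmL ℝ p))
  have hℓ : ∀ u, ℓ u = k * (-g.form p (e.symmL ℝ p u) z / √(-g.form p z z)) := by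
    intro u
    simp only [ℓ, smul_apply, ContinuousLinearMap.comp_apply, smul_eq_mul,
      g.symm p z (e.symmL ℝ p u)]
    ring
  refine ⟨ℓ, fun v ↦ by rw [hℓ, e.symmL_continuousLinearMapAt hp], ?_⟩
  have hcont : ∀ u : F, ContinuousAt
      (fun q : M × F ↦ TotalSpace.mk' F q.1 (e.symmL ℝ q.1 q.2)) (p, u) := by
    intro u
    have h1 := e.continuousOn_symm.continuousAt (x := (p, u))
      ((e.open_baseSet.prod isOpen_univ).mem_nhds ⟨hp, trivial⟩)
    refine h1.congr ?_
    filter_upwards [(e.open_baseSet.prod isOpen_univ).mem_nhds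
      (show (p, u) ∈ e.baseSet ×ˢ univ from ⟨hp, trivial⟩)] with q hq
    rw [e.symmL_apply hq.1]
  have hcT : ∀ u : F, ContinuousAt
      (fun q : M × F ↦ TotalSpace.mk' F q.1 (T.field q.1)) (p, u) := fun u ↦
    (T.continuous.comp continuous_fst).continuousAt
  have hq1 := fun u ↦ g.continuousAt_form (hcont u) (hcont u)
  have hq2 := fun u ↦ g.continuousAt_form (hcT u) (hcont u)
  -- By compactness it suffices to work near each `(p, u)`. The cone conditions are closed: where
  -- one fails at `(p, u)`, it fails nearby; where both hold, the strict bound persists.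
  have key : ∀ᶠ x in 𝓝 p, ∀ u ∈ Metric.sphere (0 : F) 1,
      g.form x (e.symmL ℝ x u) (e.symmL ℝ x u) ≤ 0 → g.form x (T.field x) (e.symmL ℝ x u) ≤ 0 →
      √(-g.form x (e.symmL ℝ x u) (e.symmL ℝ x u)) < ℓ u := by
    refine (isCompact_sphere (0 : F) 1).eventually_forall_of_forall_eventually fun u hu ↦ ?_
    by_cases h1 : 0 < g.form p (e.symmL ℝ p u) (e.symmL ℝ p u)
    · filter_upwards [(hq1 u).eventually (lt_mem_nhds h1)] with q hq h
      exact absurd h hq.not_ge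
    by_cases h2 : 0 < g.form p (T.field p) (e.symmL ℝ p u)
    · filter_upwards [(hq2 u).eventually (lt_mem_nhds h2)] with q hq _ h
      exact absurd h hq.not_ge
    push Not at h1 h2
    have hu0 : e.symmL ℝ p u ≠ 0 := by
      intro h
      have := e.continuousLinearMapAt_symmL (R := ℝ) hp u
      rw [h, map_zero] at this
      simp [← this] at hu
    have h3 := g.sqrt_neg_form_le ⟨hu0, h1⟩ hz (T.timelike p) hzT h2
    have h4 := g.form_neg_of_isCausal ⟨hu0, h1⟩ hz (T.timelike p) hzT h2
    have h5 : √(-g.form p (e.symmL ℝ p u) (e.symmL ℝ p u)) < ℓ u := by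
      rw [hℓ]
      have h6 : 0 < -g.form p (e.symmL ℝ p u) z / √(-g.form p z z) :=
        div_pos (by linarith) (Real.sqrt_pos.2 (by linarith))
      nlinarith
    have h7 : ContinuousAt (fun q : M × F ↦ ℓ q.2) (p, u) := by fun_prop
    filter_upwards [(Real.continuous_sqrt.continuousAt.comp (hq1 u).neg).eventually_lt h7 h5]
      with q hq _ _ using hq
  filter_upwards [key, e.open_baseSet.mem_nhds hp] with x hx hxe v hv
  set u := e.continuousLinearMapAt ℝ x v with hu
  have huv : e.symmL ℝ x u = v := e.symmL_continuousLinearMapAt hxe v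
  have hu0 : u ≠ 0 := by
    intro h
    rw [h, map_zero] at huv
    exact hv.1.1 huv.symm
  have hn : 0 < ‖u‖ := norm_pos_iff.2 hu0
  -- Both sides are positively homogeneous, so the unit sphere suffices.
  have h1 := hx (‖u‖⁻¹ • u) (by simp [norm_smul, hn.ne'])
  simp only [map_smul, huv, smul_apply, smul_eq_mul] at h1
  have hi : 0 < ‖u‖⁻¹ := inv_pos.2 hn
  have h2 := h1 (mul_nonpos_of_nonneg_of_nonpos hi.le (mul_nonpos_of_nonneg_of_nonpos hi.le
    hv.1.2)) (mul_nonpos_of_nonneg_of_nonpos hi.le hv.2.le)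
  rw [← mul_neg, ← mul_neg, ← mul_assoc, Real.sqrt_mul (mul_self_nonneg _),
    Real.sqrt_mul_self hi.le] at h2
  exact (lt_of_mul_lt_mul_left h2 hi.le).le

end Cone

/-! ### Length of a future causal curve inside a chart. -/

section Length

variable {d : ℕ} {M : Type*} [MetricSpace M]
  [ChartedSpace (EuclideanSpace ℝ (Fin (d + 1))) M] [IsManifold (𝓡 (d + 1)) ∞ M]
  {g : ContinuousLorentzianMetric d M} {T : g.TimeOrientation}

/-- The length of a future causal curve is bounded by the increment along the curve of a function
whose derivative dominates the length of future causal vectors. -/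
lemma IsFutureCausalCurve.setLIntegral_le {c : ℝ → M} {a b x y : ℝ}
    (hc : g.IsFutureCausalCurve T c a b) (hax : a ≤ x) (hxy : x ≤ y) (hyb : y ≤ b)
    {p : M} {U : Set M} (hU : U ⊆ (chartAt (EuclideanSpace ℝ (Fin (d + 1))) p).source)
    {C : ℝ≥0} (hC : LipschitzOnWith C (extChartAt (𝓡 (d + 1)) p) U)
    {ℓ : EuclideanSpace ℝ (Fin (d + 1)) →L[ℝ] ℝ}
    (hℓ : ∀ q ∈ U, ∀ v : TangentSpace (𝓡 (d + 1)) q, g.IsFutureCausal T v →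
        √(-g.form q v v) ≤ ℓ ((trivializationAt (EuclideanSpace ℝ (Fin (d + 1)))
          (TangentSpace (𝓡 (d + 1))) p).continuousLinearMapAt ℝ q v))
    (hcU : MapsTo c (Icc x y) U) :
    ∫⁻ t in Icc x y, ENNReal.ofReal
      √(-(g.form (c t) (curveVelocity d c (Icc a b) t) (curveVelocity d c (Icc a b) t))) ≤
    ENNReal.ofReal (ℓ (extChartAt (𝓡 (d + 1)) p (c y)) - ℓ (extChartAt (𝓡 (d + 1)) p (c x))) := by
  have hsub : Icc x y ⊆ Icc a b := Icc_subset_Icc hax hyb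
  obtain ⟨K, hK⟩ := hc.1 (Icc a b) subset_rfl isCompact_Icc
  set h : ℝ → ℝ := fun t ↦ ℓ (extChartAt (𝓡 (d + 1)) p (c t)) with hh
  have hlip : LipschitzOnWith (‖ℓ‖₊ * (C * K)) h (uIcc x y) := by
    rw [uIcc_of_le hxy]
    exact ℓ.lipschitz.comp_lipschitzOnWith (hC.comp (hK.mono hsub) hcU)
  have hac := hlip.absolutelyContinuousOnInterval
  -- On the open interval the velocity within `[a, b]` gives a two-sided derivative.
  have hderiv : ∀ᵐ t ∂(volume.restrict (Ioo x y)),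
      √(-(g.form (c t) (curveVelocity d c (Icc a b) t) (curveVelocity d c (Icc a b) t))) ≤
        deriv h t := by
    filter_upwards [ae_restrict_of_ae_restrict_of_subset (Ioo_subset_Icc_self.trans hsub) hc.2,
      ae_restrict_mem measurableSet_Ioo] with t ht1 ht2
    have htU := hcU (Ioo_subset_Icc_self ht2)
    have h1 := (mdifferentiableWithinAt_of_curveVelocity_ne_zero
      ht1.1.1).hasDerivWithinAt_extChartAt_comp (hU htU)
    have h2 := h1.hasDerivAt (Icc_mem_nhds (hax.trans_lt ht2.1) (ht2.2.trans_le hyb))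
    have h3 := ℓ.hasFDerivAt.comp_hasDerivAt t h2
    exact (hℓ _ htU _ ht1).trans_eq h3.deriv.symm
  have hint := hac.integral_deriv_eq_sub
  rw [intervalIntegral.integral_of_le hxy, integral_Ioc_eq_integral_Ioo] at hint
  have hII : IntegrableOn (deriv h) (Ioo x y) :=
    ((intervalIntegrable_iff_integrableOn_Ioc_of_le hxy).1 hac.intervalIntegrable_deriv).mono_set
      Ioo_subset_Ioc_self
  rw [← restrict_Ioo_eq_restrict_Icc]
  calc _ ≤ ∫⁻ t in Ioo x y, ENNReal.ofReal (deriv h t) := by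
        refine lintegral_mono_ae ?_
        filter_upwards [hderiv] with t ht using ENNReal.ofReal_le_ofReal ht
    _ = ENNReal.ofReal (∫ t in Ioo x y, deriv h t) := by
        refine (ofReal_integral_eq_lintegral_ofReal hII ?_).symm
        filter_upwards [hderiv] with t ht using (Real.sqrt_nonneg _).trans ht
    _ = _ := by rw [hint]

end Length

end ContinuousLorentzianMetric

/-! ### Passing to the limit over short intervals. -/

namespace ContinuousLorentzianMetric

variable {d : ℕ} {M : Type*} [MetricSpace M]
  [ChartedSpace (EuclideanSpace ℝ (Fin (d + 1))) M] [IsManifold (𝓡 (d + 1)) ∞ M]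
  [RiemannianBundle (fun x : M ↦ TangentSpace (𝓡 (d + 1)) x)]
  [IsContMDiffRiemannianBundle (𝓡 (d + 1)) ∞ (EuclideanSpace ℝ (Fin (d + 1)))
    (fun x : M ↦ TangentSpace (𝓡 (d + 1)) x)]
  [IsRiemannianManifold (𝓡 (d + 1)) M]
  {g : ContinuousLorentzianMetric d M} {T : g.TimeOrientation}

/-- Near each parameter, the upper limit of the lengths of a uniformly convergent sequence of future
causal curves is bounded by the increment along the limit of a function whose derivative dominates
the length of future causal vectors. -/
lemma exists_ball_limsup_setLIntegral_le {a b : ℝ} {γ : ℝ → M} {γn : ℕ → ℝ → M}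
    (hγn : ∀ n, g.IsFutureCausalCurve T (γn n) a b) (hγ : IsLocallyLipschitzian γ (Icc a b))
    (hconv : TendstoUniformlyOn γn γ atTop (Icc a b)) {t₀ : ℝ} (ht₀ : t₀ ∈ Icc a b)
    {ℓ : EuclideanSpace ℝ (Fin (d + 1)) →L[ℝ] ℝ}
    (hℓ : ∀ᶠ q in 𝓝 (γ t₀), ∀ v : TangentSpace (𝓡 (d + 1)) q, g.IsFutureCausal T v →
        √(-g.form q v v) ≤ ℓ ((trivializationAt (EuclideanSpace ℝ (Fin (d + 1)))
          (TangentSpace (𝓡 (d + 1))) (γ t₀)).continuousLinearMapAt ℝ q v)) :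
    ∃ r > 0,
      (∃ K : ℝ≥0, LipschitzOnWith K (fun t ↦ ℓ (extChartAt (𝓡 (d + 1)) (γ t₀) (γ t)))
        (Icc a b ∩ Metric.ball t₀ r)) ∧
      ∀ x ∈ Icc a b, ∀ y ∈ Icc a b, x ∈ Metric.ball t₀ r → y ∈ Metric.ball t₀ r → x ≤ y →
        limsup (fun n ↦ ∫⁻ t in Icc x y, ENNReal.ofReal √(-(g.form (γn n t)
          (curveVelocity d (γn n) (Icc a b) t) (curveVelocity d (γn n) (Icc a b) t)))) atTop ≤
        ENNReal.ofReal (ℓ (extChartAt (𝓡 (d + 1)) (γ t₀) (γ y)) -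
          ℓ (extChartAt (𝓡 (d + 1)) (γ t₀) (γ x))) := by
  set p := γ t₀
  have : IsContinuousRiemannianBundle (EuclideanSpace ℝ (Fin (d + 1)))
      (fun x : M ↦ TangentSpace (𝓡 (d + 1)) x) :=
    IsContMDiffRiemannianBundle.isContinuousRiemannianBundle (𝓡 (d + 1)) (n := ∞)
  obtain ⟨C, V, hV, hC⟩ := exists_lipschitzOnWith_extChartAt (𝓡 (d + 1)) p
  obtain ⟨ε, hε, hU⟩ := Metric.mem_nhds_iff.1 (inter_mem (inter_mem hℓ hV)
    (chart_source_mem_nhds (EuclideanSpace ℝ (Fin (d + 1))) p))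
  obtain ⟨K, hK⟩ := hγ (Icc a b) subset_rfl isCompact_Icc
  have hcont := hK.continuousOn t₀ ht₀
  obtain ⟨r, hr, hball⟩ := Metric.mem_nhdsWithin_iff.1
    (hcont (Metric.ball_mem_nhds p (half_pos hε)))
  have hball' : ∀ t ∈ Icc a b, t ∈ Metric.ball t₀ r → dist (γ t) p < ε / 2 :=
    fun t h1 h2 ↦ hball ⟨h2, h1⟩
  have hγU : ∀ t ∈ Icc a b, t ∈ Metric.ball t₀ r → γ t ∈ Metric.ball p ε :=
    fun t h1 h2 ↦ (hball' t h1 h2).trans (half_lt_self hε)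
  have hCU : LipschitzOnWith C (extChartAt (𝓡 (d + 1)) p) (Metric.ball p ε) :=
    hC.mono fun q hq ↦ (hU hq).1.2
  refine ⟨r, hr, ⟨‖ℓ‖₊ * (C * K), ?_⟩, fun x hx y hy hxr hyr hxy ↦ ?_⟩
  · exact ℓ.lipschitz.comp_lipschitzOnWith (hCU.comp (hK.mono inter_subset_left)
      fun t ht ↦ hγU t ht.1 ht.2)
  have hlim : ∀ t ∈ Icc a b, t ∈ Metric.ball t₀ r →
      Tendsto (fun n ↦ ℓ (extChartAt (𝓡 (d + 1)) p (γn n t))) atTop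
        (𝓝 (ℓ (extChartAt (𝓡 (d + 1)) p (γ t)))) := fun t h1 h2 ↦
    (ℓ.continuous.tendsto _).comp ((hCU.continuousOn.continuousAt
      (Metric.isOpen_ball.mem_nhds (hγU t h1 h2))).tendsto.comp (hconv.tendsto_at h1))
  -- The increment converges by convergence at the endpoints alone; uniform convergence serves to
  -- keep `γn` in the chart ball.
  have hlim' := ENNReal.tendsto_ofReal ((hlim y hy hyr).sub (hlim x hx hxr))
  rw [← hlim'.limsup_eq]
  refine limsup_le_limsup ?_
  filter_upwards [Metric.tendstoUniformlyOn_iff.1 hconv (ε / 2) (half_pos hε)] with n hn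
  refine (hγn n).setLIntegral_le hx.1 hxy hy.2 (fun q hq ↦ (hU hq).2) hCU
    (fun q hq ↦ (hU hq).1.1) fun t ht ↦ ?_
  have ht' : t ∈ Icc a b := ⟨hx.1.trans ht.1, ht.2.trans hy.2⟩
  have htr : t ∈ Metric.ball t₀ r := by
    rw [Real.ball_eq_Ioo] at *
    exact ⟨hxr.1.trans_le ht.1, ht.2.trans_lt hyr.2⟩
  calc dist (γn n t) p ≤ dist (γ t) (γn n t) + dist (γ t) p := by
        rw [dist_comm (γ t) (γn n t)]
        exact dist_triangle _ _ _
    _ < ε / 2 + ε / 2 := add_lt_add (hn t ht') (hball' t ht' htr)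
    _ = ε := add_halves ε

end ContinuousLorentzianMetric

/-- Upper semicontinuity of the Lorentzian length on future causal curves. -/
theorem mainTheorem5 {d : ℕ} {M : Type*} [MetricSpace M] [ConnectedSpace M]
    [ChartedSpace (EuclideanSpace ℝ (Fin (d + 1))) M] [IsManifold (𝓡 (d + 1)) ∞ M]
    -- the auxiliary complete Riemannian metric `h`, whose distance is that of `M`
    [RiemannianBundle (fun x : M ↦ TangentSpace (𝓡 (d + 1)) x)]
    [IsContMDiffRiemannianBundle (𝓡 (d + 1)) ∞ (EuclideanSpace ℝ (Fin (d + 1)))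
      (fun x : M ↦ TangentSpace (𝓡 (d + 1)) x)]
    [IsRiemannianManifold (𝓡 (d + 1)) M] [CompleteSpace M]
    (g : ContinuousLorentzianMetric d M) (T : g.TimeOrientation)
    (a b : ℝ) (hab : a ≤ b) (γ : ℝ → M) (γn : ℕ → ℝ → M)
    (hγn : ∀ n, g.IsFutureCausalCurve T (γn n) a b)
    (hγ : g.IsCausalCurve γ a b)
    (hconv : TendstoUniformlyOn γn γ atTop (Icc a b)) :
    limsup (fun n ↦ g.length (γn n) a b) atTop ≤ g.length γ a b := by
  refine limsup_setLIntegral_Icc_le_of_locallyLipschitz hab (fun t₀ ht₀ ↦ ?_) ?_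
  -- The Lipschitz bound needs no sharp constant: `z = T` and `k = 2` suffice.
  · obtain ⟨ℓ, -, hℓ⟩ := g.exists_eventually_sqrt_neg_form_le T (T.timelike (γ t₀))
      (T.timelike (γ t₀)) one_lt_two
    obtain ⟨r, hr, ⟨K, hK⟩, h⟩ :=
      g.exists_ball_limsup_setLIntegral_le hγn hγ.1 hconv ht₀ hℓ
    refine ⟨r, hr, K, fun x hx y hy hxr hyr hxy ↦
      (h x hx y hy hxr hyr hxy).trans (ENNReal.ofReal_le_ofReal ?_)⟩
    have := hK.dist_le_mul y ⟨hy, hyr⟩ x ⟨hx, hxr⟩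
    rw [Real.dist_eq, Real.dist_eq, abs_of_nonneg (sub_nonneg.2 hxy)] at this
    exact (le_abs_self _).trans this
  · rw [← restrict_Ioo_eq_restrict_Icc]
    filter_upwards [ae_restrict_of_ae_restrict_of_subset Ioo_subset_Icc_self hγ.2,
      ae_restrict_mem measurableSet_Ioo] with t₀ hv ht₀ c hc
    have ht₀' := Ioo_subset_Icc_self ht₀
    set v := curveVelocity d γ (Icc a b) t₀
    obtain ⟨z, hz, hzT, hzc⟩ := g.exists_timelike_div_lt hv.2 (T.timelike (γ t₀)) hc
    obtain ⟨k, hkc, hk⟩ : ∃ k, k * (-g.form (γ t₀) v z / √(-g.form (γ t₀) z z)) < c ∧ 1 < k := by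
      have h1 : ContinuousAt (fun k : ℝ ↦ k * (-g.form (γ t₀) v z / √(-g.form (γ t₀) z z))) 1 := by
        fun_prop
      have h2 := h1.eventually_lt continuousAt_const (by simpa using hzc)
      exact ((h2.filter_mono nhdsWithin_le_nhds).and
        (self_mem_nhdsWithin : Ioi (1 : ℝ) ∈ 𝓝[>] 1)).exists
    obtain ⟨ℓ, hℓv, hℓ⟩ := g.exists_eventually_sqrt_neg_form_le T hz hzT hk
    obtain ⟨r, hr, -, h⟩ :=
      g.exists_ball_limsup_setLIntegral_le hγn hγ.1 hconv ht₀' hℓ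
    have hmem : Icc a b ∈ 𝓝 t₀ := Icc_mem_nhds ht₀.1 ht₀.2
    have hd := ((mdifferentiableWithinAt_of_curveVelocity_ne_zero
      hv.1).hasDerivWithinAt_extChartAt_comp
        (mem_chart_source (EuclideanSpace ℝ (Fin (d + 1))) (γ t₀))).hasDerivAt hmem
    have hd' := ℓ.hasFDerivAt.comp_hasDerivAt t₀ hd
    -- The slopes of `ℓ` along `γ` tend to `ℓ` of the velocity, which is below `c` by the choice of
    -- `z` and `k`.
    have hslope := ((hasDerivAt_iff_tendsto_slope.1 hd').mono_left
      (nhdsGT_le_nhdsNE t₀)).eventually (gt_mem_nhds ((hℓv v).trans_lt hkc))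
    filter_upwards [hslope, self_mem_nhdsWithin, nhdsWithin_le_nhds hmem,
      nhdsWithin_le_nhds (Metric.ball_mem_nhds t₀ hr)] with y hy hty hyI hyr
    refine (h t₀ ht₀' y hyI (Metric.mem_ball_self hr) hyr (le_of_lt hty)).trans
      (ENNReal.ofReal_le_ofReal ?_)
    rw [slope_def_field, div_lt_iff₀ (sub_pos.2 hty)] at hy
    exact hy.le
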